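/- In this statement a *2-complex* is a nonempty connected CW complex of dimension at most $2$ with at most countably many cells. A path-connected space $X$ is *aspherical* if it has a universal cover, i.e. a covering map $\tilde X\to X$ with $\tilde X$ simply connected, whose total space $\tilde X$ is contractible. Subcomplexes carry the subspace topology, and a connected subcomplex is nonempty. **Lemma 2.2.** Suppose that for every contractible 2-complex $X$, every connected subcomplex of $X$ is aspherical. Then for every aspherical 2-complex $P$, every connected subcomplex $Q$ of $P$ is aspherical. -/

import Mathlib

open Set Topology

universe u

/-- A 2-complex: a nonempty connected Hausdorff space equal to a CW complex with at most countably
many cells, all of dimension at most `2` (there may be no `2`-cells, or no `1`-cells). -/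
structure IsTwoComplex (X : Type u) [TopologicalSpace X] [CWComplex (univ : Set X)] : Prop where
  t2 : T2Space X
  connected : ConnectedSpace X
  countable_cell : ∀ n, Countable (RelCWComplex.cell (univ : Set X) n)
  isEmpty_cell : ∀ n, 2 < n → IsEmpty (RelCWComplex.cell (univ : Set X) n)

/-- `p : E → X` is a universal cover of `X`: a covering map with simply connected total space.
(A covering map with nonempty total space is automatically surjective when `X` is connected.) -/
def IsUniversalCover {E X : Type u} [TopologicalSpace E] [TopologicalSpace X] (p : E → X) : Prop :=
  IsCoveringMap p ∧ SimplyConnectedSpace E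

/-- A path-connected space is aspherical if it has a contractible universal cover. -/
def IsAspherical (X : Type u) [TopologicalSpace X] : Prop :=
  PathConnectedSpace X ∧ ∃ (E : Type u) (_ : TopologicalSpace E) (p : E → X),
    IsUniversalCover p ∧ ContractibleSpace E

/-! Let `p : E → P` be a contractible universal cover. The cells of `P` lift, so `E` is a
contractible 2-complex, and a component `K` of `p ⁻¹' Q` is a connected subcomplex of it. By
hypothesis `K` has a contractible universal cover `r : E' → K`; the composite `E' → K → Q` is the
desired cover of `Q`.

The obstacle is that a composite of covering maps need not be a covering map. What does survive
composition is being a local homeomorphism through which all characteristic maps lift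
(`IsCellwiseCovering`). Such a map between Hausdorff spaces gives its total space a CW structure
whose cells are the lifts (`IsCellwiseCovering.cwComplex`), and over a finite-dimensional base it is
a covering map (`IsCellularCovering.isCoveringMap`): an open cell is evenly covered by its lifts,
and radial collars extend the even covering one dimension at a time until it lives over an open set.
-/

open RelCWComplex (cell openCell closedCell cellFrontier skeletonLT)

section BallRetraction

variable {V : Type*} [NormedAddCommGroup V] [NormedSpace ℝ V]

/-- The radial retraction of a normed space onto its closed unit ball. -/
noncomputable def ballRetraction (v : V) : V := (max 1 ‖v‖)⁻¹ • v

theorem continuous_ballRetraction : Continuous (ballRetraction : V → V) :=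
  ((continuous_const.max continuous_norm).inv₀ fun _ ↦ by positivity).smul continuous_id

theorem ballRetraction_mem (v : V) : ballRetraction v ∈ Metric.closedBall (0 : V) 1 := by
  have h : 0 < max 1 ‖v‖ := by positivity
  rw [mem_closedBall_zero_iff, ballRetraction, norm_smul, norm_inv, Real.norm_of_nonneg h.le,
    inv_mul_le_iff₀ h, mul_one]
  exact le_max_right _ _

theorem ballRetraction_of_mem {v : V} (hv : v ∈ Metric.closedBall (0 : V) 1) :
    ballRetraction v = v := by
  rw [mem_closedBall_zero_iff] at hv
  simp [ballRetraction, max_eq_left hv]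

theorem norm_inv_smul_mem_sphere {v : V} (hv : v ≠ 0) : ‖v‖⁻¹ • v ∈ Metric.sphere (0 : V) 1 := by
  simp [norm_smul, hv]

end BallRetraction

namespace Topology.CWComplex

/-! ### Characteristic maps extended to all of `ℝⁿ` -/

section CharMap

variable {X : Type u} [TopologicalSpace X] {C : Set X} [CWComplex C]

/-- The characteristic map of a cell, extended to the whole of `Fin n → ℝ` by precomposing with
the radial retraction onto the closed unit ball. -/
noncomputable def charMap (n : ℕ) (j : cell C n) : C(Fin n → ℝ, X) where
  toFun v := RelCWComplex.map n j (ballRetraction v)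
  continuous_toFun := (RelCWComplex.continuousOn n j).comp_continuous continuous_ballRetraction
    ballRetraction_mem

theorem charMap_of_mem {n : ℕ} (j : cell C n) {v : Fin n → ℝ}
    (hv : v ∈ Metric.closedBall (0 : Fin n → ℝ) 1) : charMap n j v = RelCWComplex.map n j v := by
  simp [charMap, ballRetraction_of_mem hv]

theorem charMap_ballRetraction {n : ℕ} (j : cell C n) (v : Fin n → ℝ) :
    charMap n j (ballRetraction v) = charMap n j v := by
  simp [charMap, ballRetraction_of_mem (ballRetraction_mem v)]

theorem charMap_image_closedBall {n : ℕ} (j : cell C n) :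
    charMap n j '' Metric.closedBall 0 1 = closedCell n j :=
  image_congr fun _ hv ↦ charMap_of_mem j hv

theorem charMap_image_ball {n : ℕ} (j : cell C n) :
    charMap n j '' Metric.ball 0 1 = openCell n j :=
  image_congr fun _ hv ↦ charMap_of_mem j (Metric.ball_subset_closedBall hv)

theorem charMap_mem_closedCell {n : ℕ} (j : cell C n) (v : Fin n → ℝ) :
    charMap n j v ∈ closedCell n j :=
  mem_image_of_mem _ (ballRetraction_mem v)

theorem charMap_mem_openCell {n : ℕ} (j : cell C n) {v : Fin n → ℝ}
    (hv : v ∈ Metric.ball (0 : Fin n → ℝ) 1) : charMap n j v ∈ openCell n j :=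
  charMap_image_ball j ▸ mem_image_of_mem _ hv

theorem charMap_mem_cellFrontier {n : ℕ} (j : cell C n) {v : Fin n → ℝ}
    (hv : v ∈ Metric.sphere (0 : Fin n → ℝ) 1) : charMap n j v ∈ cellFrontier n j :=
  ⟨v, hv, (charMap_of_mem j (Metric.sphere_subset_closedBall hv)).symm⟩

theorem range_charMap {n : ℕ} (j : cell C n) : range (charMap n j) = closedCell n j :=
  (range_subset_iff.2 (charMap_mem_closedCell j)).antisymm
    (charMap_image_closedBall j ▸ image_subset_range _ _)

theorem isPreconnected_closedCell {n : ℕ} (j : cell C n) : IsPreconnected (closedCell n j) :=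
  range_charMap j ▸ isPreconnected_range (charMap n j).continuous

theorem charMap_injOn {n : ℕ} (j : cell C n) : InjOn (charMap n j) (Metric.ball 0 1) := by
  have h := (RelCWComplex.map n j).injOn
  rw [RelCWComplex.source_eq] at h
  exact h.congr fun v hv ↦ (charMap_of_mem j (Metric.ball_subset_closedBall hv)).symm

theorem eq_of_charMap_eq {n : ℕ} {i j : cell C n} {v w : Fin n → ℝ}
    (hv : v ∈ Metric.ball (0 : Fin n → ℝ) 1) (hw : w ∈ Metric.ball (0 : Fin n → ℝ) 1)
    (h : charMap n i v = charMap n j w) : i = j ∧ v = w := by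
  have hij : (⟨n, i⟩ : Σ n, cell C n) = ⟨n, j⟩ := RelCWComplex.eq_of_not_disjoint_openCell
    (not_disjoint_iff.2 ⟨_, charMap_mem_openCell i hv, h ▸ charMap_mem_openCell j hw⟩)
  obtain rfl : i = j := by simpa using hij
  exact ⟨rfl, charMap_injOn i hv hw h⟩

end CharMap

/-! ### Tests on cells: open sets, components, countability -/

section WeakTopology

variable {X : Type u} [TopologicalSpace X] [CWComplex (univ : Set X)]

theorem exists_mem_openCell (x : X) :
    ∃ (n : ℕ) (j : cell (univ : Set X) n), x ∈ openCell n j := by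
  simpa using (iUnion_openCell_eq_complex (C := (univ : Set X))).ge (mem_univ x)

theorem exists_charMap_eq (x : X) :
    ∃ (n : ℕ) (j : cell (univ : Set X) n), ∃ v ∈ Metric.ball (0 : Fin n → ℝ) 1,
      charMap n j v = x := by
  obtain ⟨n, j, hx⟩ := exists_mem_openCell x
  rw [← charMap_image_ball] at hx
  exact ⟨n, j, hx⟩

variable [T2Space X]

theorem isOpen_of_charMap_preimage {O : Set X}
    (h : ∀ n (j : cell (univ : Set X) n), IsOpen (charMap n j ⁻¹' O)) : IsOpen O := by
  rw [← isClosed_compl_iff, CWComplex.closed univ _ (subset_univ _)]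
  intro n j
  have : Oᶜ ∩ closedCell n j =
      charMap n j '' (Metric.closedBall 0 1 ∩ (charMap n j ⁻¹' O)ᶜ) := by
    rw [← preimage_compl, image_inter_preimage, charMap_image_closedBall, inter_comm]
  rw [this]
  exact (((isCompact_closedBall _ _).inter_right (h n j).isClosed_compl).image
    (charMap n j).continuous).isClosed

theorem isClosed_of_closedCell_subset_or_disjoint {A : Set X}
    (h : ∀ n (j : cell (univ : Set X) n), closedCell n j ⊆ A ∨ Disjoint A (closedCell n j)) :
    IsClosed A := by
  rw [CWComplex.closed univ _ (subset_univ _)]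
  intro n j
  rcases h n j with h | h
  · rw [inter_eq_right.2 h]
    exact CWComplex.isClosed_closedCell
  · rw [h.inter_eq]
    exact isClosed_empty

theorem isClopen_of_closedCell_subset_or_disjoint {A : Set X}
    (h : ∀ n (j : cell (univ : Set X) n), closedCell n j ⊆ A ∨ Disjoint A (closedCell n j)) :
    IsClopen A := by
  refine ⟨isClosed_of_closedCell_subset_or_disjoint h, ?_⟩
  rw [← isClosed_compl_iff]
  refine isClosed_of_closedCell_subset_or_disjoint fun n j ↦ (h n j).symm.imp ?_ ?_
  · exact fun h ↦ h.subset_compl_left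
  · exact fun h ↦ disjoint_compl_left_iff_subset.2 h

/-- Closed cells are connected, so each one lies in the component or misses it. -/
theorem isClopen_connectedComponent (x : X) : IsClopen (connectedComponent x) := by
  refine isClopen_of_closedCell_subset_or_disjoint fun n j ↦ ?_
  by_cases h : Disjoint (connectedComponent x) (closedCell n j)
  · exact .inr h
  · obtain ⟨y, hy, hyj⟩ := not_disjoint_iff.1 h
    refine .inl ?_
    rw [connectedComponent_eq hy]
    exact (isPreconnected_closedCell j).subset_connectedComponent hyj

/-- In a connected CW complex in which every closed cell meets only countably many closed cells,
there are only countably many cells. -/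
theorem countable_sigma_cell [PreconnectedSpace X]
    (h : ∀ a : Σ n, cell (univ : Set X) n, {b : Σ n, cell (univ : Set X) n |
      (closedCell a.1 a.2 ∩ closedCell b.1 b.2).Nonempty}.Countable) :
    Countable (Σ n, cell (univ : Set X) n) := by
  rcases isEmpty_or_nonempty (Σ n, cell (univ : Set X) n) with hE | ⟨⟨a⟩⟩
  · infer_instance
  let N (a : Σ n, cell (univ : Set X) n) : Set (Σ n, cell (univ : Set X) n) :=
    {b | (closedCell a.1 a.2 ∩ closedCell b.1 b.2).Nonempty}
  -- `T k` holds the cells reached from `a` by a chain of `k` moves between meeting closed cells;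
  -- their union `A` is clopen.
  let T (k : ℕ) : Set (Σ n, cell (univ : Set X) n) :=
    Nat.rec {a} (fun _ S ↦ ⋃ b ∈ S, N b) k
  have hT (k : ℕ) : (T k).Countable := by
    induction k with
    | zero => exact countable_singleton a
    | succ k ih => exact ih.biUnion fun b _ ↦ h b
  let A : Set X := ⋃ k, ⋃ b ∈ T k, closedCell b.1 b.2
  have hA (b : Σ n, cell (univ : Set X) n) (hb : ¬ Disjoint A (closedCell b.1 b.2)) :
      b ∈ ⋃ k, T k := by
    obtain ⟨y, hy, hyb⟩ := not_disjoint_iff.1 hb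
    simp only [A, mem_iUnion] at hy
    obtain ⟨k, c, hc, hyc⟩ := hy
    exact mem_iUnion.2 ⟨k + 1, mem_biUnion hc ⟨y, hyc, hyb⟩⟩
  have hclopen : IsClopen A := isClopen_of_closedCell_subset_or_disjoint fun n j ↦ by
    by_cases hj : Disjoint A (closedCell n j)
    · exact .inr hj
    · obtain ⟨k, hk⟩ := mem_iUnion.1 (hA ⟨n, j⟩ hj)
      exact .inl (subset_iUnion_of_subset k (subset_biUnion_of_mem (u := fun b : Σ n,
        cell (univ : Set X) n ↦ closedCell b.1 b.2) hk))
  have huniv : A = univ := hclopen.eq_univ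
    ((RelCWComplex.closedCell_nonempty a.1 a.2).mono
      (subset_iUnion_of_subset 0 (subset_biUnion_of_mem (u := fun b : Σ n,
        cell (univ : Set X) n ↦ closedCell b.1 b.2) (mem_singleton a))))
  rw [← countable_univ_iff]
  refine (countable_iUnion hT).mono fun b _ ↦ hA b ?_
  rw [huniv, univ_disjoint]
  exact (RelCWComplex.closedCell_nonempty b.1 b.2).ne_empty

end WeakTopology

/-! ### A subcomplex as a CW complex in its own right -/

section Subtype

variable {X : Type u} [TopologicalSpace X] [T2Space X] (C : Set X) [CWComplex C]

/-- A CW complex in a Hausdorff space, seen as a CW structure on the corresponding subspace. -/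
@[reducible]
noncomputable def subtype : CWComplex (univ : Set C) where
  cell n := cell C n
  map n j :=
    { toFun v := ⟨charMap n j v, closedCell_subset_complex n j (charMap_mem_closedCell j v)⟩
      invFun x := (RelCWComplex.map n j).symm x
      source := Metric.ball 0 1
      target := Subtype.val ⁻¹' openCell n j
      map_source' v hv := charMap_mem_openCell j hv
      map_target' := by
        rintro x ⟨v, hv, hx⟩
        rw [← hx, (RelCWComplex.map n j).left_inv (by rwa [RelCWComplex.source_eq])]
        exact hv
      left_inv' v hv := by
        simp only [charMap_of_mem j (Metric.ball_subset_closedBall hv)]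
        exact (RelCWComplex.map n j).left_inv (by rwa [RelCWComplex.source_eq])
      right_inv' := by
        rintro x ⟨v, hv, hx⟩
        have h := (RelCWComplex.map n j).left_inv (x := v) (by rwa [RelCWComplex.source_eq])
        rw [Subtype.ext_iff]
        simp only [← hx, h]
        exact charMap_of_mem j (Metric.ball_subset_closedBall hv) }
  source_eq n j := rfl
  continuousOn n j := (((charMap n j).continuous).subtype_mk _).continuousOn
  continuousOn_symm n j := by
    refine (RelCWComplex.continuousOn_symm n j).comp continuous_subtype_val.continuousOn ?_
    intro x hx
    rw [← PartialEquiv.image_source_eq_target, RelCWComplex.source_eq]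
    exact hx
  pairwiseDisjoint' := by
    rintro ⟨n, i⟩ - ⟨m, j⟩ - hij
    rw [Function.onFun, disjoint_left]
    rintro _ ⟨v, hv, rfl⟩ ⟨w, hw, h⟩
    refine (RelCWComplex.disjoint_openCell_of_ne hij).notMem_of_mem_left
      (charMap_mem_openCell i hv) ?_
    have hji : charMap m j w = charMap n i v := congrArg Subtype.val h
    exact hji ▸ charMap_mem_openCell j hw
  mapsTo' n i := by
    obtain ⟨I, hI⟩ := CWComplex.mapsTo n i
    refine ⟨I, fun v hv ↦ ?_⟩
    have h := hI hv
    simp only [mem_iUnion] at h ⊢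
    obtain ⟨m, hm, j, hj, w, hw, hwv⟩ := h
    refine ⟨m, hm, j, hj, w, hw, Subtype.ext ?_⟩
    exact (charMap_of_mem j hw).trans
      (hwv.trans (charMap_of_mem i (Metric.sphere_subset_closedBall hv)).symm)
  closed' A _ hA := by
    have hC : IsClosed (Subtype.val '' A) := by
      rw [CWComplex.closed C _ (by simp)]
      intro n j
      have := RelCWComplex.isClosed (C := C) |>.isClosedEmbedding_subtypeVal.isClosedMap _ (hA n j)
      convert! this using 1
      rw [image_inter Subtype.val_injective, ← charMap_image_closedBall, image_image]
    rw [← preimage_image_eq A Subtype.val_injective]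
    exact hC.preimage continuous_subtype_val
  union' := by
    refine eq_univ_of_forall fun x ↦ ?_
    have h := (CWComplex.union (C := C)).ge x.2
    simp only [mem_iUnion] at h ⊢
    obtain ⟨n, j, v, hv, hx⟩ := h
    exact ⟨n, j, v, hv, Subtype.ext ((charMap_of_mem j hv).trans hx)⟩

end Subtype

end Topology.CWComplex

/-! ### Lifting a CW structure to the total space -/

namespace Topology.CWComplex

variable {X E : Type u} [TopologicalSpace X] [TopologicalSpace E]

/-- A local homeomorphism to a CW complex through which all characteristic maps lift, with
prescribed initial values. -/
structure IsCellwiseCovering [CWComplex (univ : Set X)] (f : E → X) : Prop where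
  isLocalHomeomorph : IsLocalHomeomorph f
  exists_lift : ∀ {n : ℕ} (j : cell (univ : Set X) n) (v : Fin n → ℝ) (y : E),
    f y = charMap n j v → ∃ F : C(Fin n → ℝ, E), (∀ w, f (F w) = charMap n j w) ∧ F v = y

namespace IsCellwiseCovering

theorem lift_unique [CWComplex (univ : Set X)] [T2Space E] {f : E → X} (hf : IsCellwiseCovering f)
    {n : ℕ} {j : cell (univ : Set X) n} {F G : C(Fin n → ℝ, E)}
    (hF : ∀ w, f (F w) = charMap n j w) (hG : ∀ w, f (G w) = charMap n j w)
    {v : Fin n → ℝ} (h : F v = G v) : F = G :=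
  DFunLike.coe_injective <| (T2Space.isSeparatedMap f).eq_of_comp_eq
    hf.isLocalHomeomorph.isLocallyInjective F.continuous G.continuous
    (funext fun w ↦ (hF w).trans (hG w).symm) v h

/-- Precomposing `F` with the retraction gives another lift of the same map, equal to `F` at the
origin. Hence the closed ball already carries all of `F`. -/
theorem lift_ballRetraction [CWComplex (univ : Set X)] [T2Space E] {f : E → X}
    (hf : IsCellwiseCovering f) {n : ℕ} {j : cell (univ : Set X) n} {F : C(Fin n → ℝ, E)}
    (hF : ∀ w, f (F w) = charMap n j w) (v : Fin n → ℝ) : F (ballRetraction v) = F v := by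
  have := hf.lift_unique (F := F.comp ⟨ballRetraction, continuous_ballRetraction⟩) (G := F) (v := 0)
    (fun w ↦ (hF _).trans (charMap_ballRetraction j w)) hF (by simp [ballRetraction])
  exact DFunLike.congr_fun this v

theorem lift_image_closedBall [CWComplex (univ : Set X)] [T2Space E] {f : E → X}
    (hf : IsCellwiseCovering f) {n : ℕ} {j : cell (univ : Set X) n} {F : C(Fin n → ℝ, E)}
    (hF : ∀ w, f (F w) = charMap n j w) : F '' Metric.closedBall 0 1 = range F := by
  refine (image_subset_range _ _).antisymm ?_
  rintro _ ⟨v, rfl⟩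
  exact ⟨ballRetraction v, ballRetraction_mem v, hf.lift_ballRetraction hF v⟩

/-- Only finitely many lifts of a given cell meet a given compact set. -/
theorem finite_lifts_meeting [CWComplex (univ : Set X)] [T2Space X] [T2Space E] {f : E → X}
    (hf : IsCellwiseCovering f) {K : Set E} (hK : IsCompact K) {n : ℕ}
    (j : cell (univ : Set X) n) :
    {F : C(Fin n → ℝ, E) | (∀ w, f (F w) = charMap n j w) ∧
      (F '' Metric.closedBall 0 1 ∩ K).Nonempty}.Finite := by
  -- In the fibre product `Z`, the graphs of the lifts are open and cover. Distinct lifts have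
  -- disjoint graphs, so a finite subcover of the compact part `K'` contains every lift that meets
  -- `K`.
  let Z : Set ((Fin n → ℝ) × E) := {z | f z.2 = charMap n j z.1}
  have hZ : IsClosed Z := isClosed_eq (hf.isLocalHomeomorph.continuous.comp continuous_snd)
    ((charMap n j).continuous.comp continuous_fst)
  let K' : Set Z := Subtype.val ⁻¹' (Metric.closedBall 0 1 ×ˢ K)
  have hK' : IsCompact K' :=
    hZ.isClosedEmbedding_subtypeVal.isCompact_preimage ((isCompact_closedBall _ _).prod hK)
  let L := {F : C(Fin n → ℝ, E) // ∀ w, f (F w) = charMap n j w}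
  let U (F : L) : Set Z := {z | F.1 z.1.1 = z.1.2}
  have hU (F : L) : IsOpen (U F) := by
    refine hf.isLocalHomeomorph.isLocallyInjective.isOpen_eqLocus ?_ ?_ ?_
    · exact F.1.continuous.comp (continuous_fst.comp continuous_subtype_val)
    · exact continuous_snd.comp continuous_subtype_val
    · exact funext fun z : Z ↦ (F.2 _).trans z.2.symm
  obtain ⟨t, ht⟩ := hK'.elim_finite_subcover U hU fun z _ ↦ by
    obtain ⟨F, hF, hFz⟩ := hf.exists_lift j z.1.1 z.1.2 z.2
    exact mem_iUnion.2 ⟨⟨F, hF⟩, hFz⟩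
  refine (t.finite_toSet.image Subtype.val).subset ?_
  rintro F ⟨hF, _, ⟨v, hv, rfl⟩, hvK⟩
  have hz : (⟨(v, F v), hF v⟩ : Z) ∈ K' := ⟨hv, hvK⟩
  obtain ⟨G, hG, hGv⟩ := mem_iUnion₂.1 (ht hz)
  exact ⟨G, hG, hf.lift_unique G.2 hF hGv⟩

/-- The total space of a cellwise covering of a CW complex is a CW complex, whose cells are the
lifts of the cells of the base. -/
@[reducible]
noncomputable def cwComplex [CWComplex (univ : Set X)] [T2Space X] [T2Space E] {f : E → X}
    (hf : IsCellwiseCovering f) : CWComplex (univ : Set E) where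
  cell n := Σ j : cell (univ : Set X) n, {F : C(Fin n → ℝ, E) // ∀ w, f (F w) = charMap n j w}
  map n j :=
    { toFun := j.2.1
      invFun y := (RelCWComplex.map n j.1).symm (f y)
      source := Metric.ball 0 1
      target := j.2.1 '' Metric.ball 0 1
      map_source' v hv := mem_image_of_mem _ hv
      map_target' := by
        rintro _ ⟨v, hv, rfl⟩
        rw [j.2.2, charMap_of_mem j.1 (Metric.ball_subset_closedBall hv),
          (RelCWComplex.map n j.1).left_inv (by rwa [RelCWComplex.source_eq])]
        exact hv
      left_inv' v hv := by
        rw [j.2.2, charMap_of_mem j.1 (Metric.ball_subset_closedBall hv),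
          (RelCWComplex.map n j.1).left_inv (by rwa [RelCWComplex.source_eq])]
      right_inv' := by
        rintro _ ⟨v, hv, rfl⟩
        rw [j.2.2, charMap_of_mem j.1 (Metric.ball_subset_closedBall hv),
          (RelCWComplex.map n j.1).left_inv (by rwa [RelCWComplex.source_eq])] }
  source_eq n j := rfl
  continuousOn n j := j.2.1.continuous.continuousOn
  continuousOn_symm n j := by
    refine (RelCWComplex.continuousOn_symm n j.1).comp
      hf.isLocalHomeomorph.continuous.continuousOn ?_
    rintro _ ⟨v, hv, rfl⟩
    rw [← PartialEquiv.image_source_eq_target, RelCWComplex.source_eq, j.2.2]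
    exact charMap_mem_openCell j.1 hv
  pairwiseDisjoint' := by
    rintro ⟨n, i, F, hF⟩ - ⟨m, j, G, hG⟩ - hij
    rw [Function.onFun, disjoint_left]
    rintro _ ⟨v, hv, rfl⟩ ⟨w, hw, h⟩
    replace h : G w = F v := h
    have hvw : charMap n i v = charMap m j w := by rw [← hF, ← hG, h]
    have hnm : (⟨n, i⟩ : Σ n, cell (univ : Set X) n) = ⟨m, j⟩ :=
      RelCWComplex.eq_of_not_disjoint_openCell
        (not_disjoint_iff.2 ⟨_, charMap_mem_openCell i hv, hvw ▸ charMap_mem_openCell j hw⟩)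
    obtain ⟨rfl, hnm⟩ := Sigma.mk.inj hnm
    obtain rfl := eq_of_heq hnm
    obtain rfl := charMap_injOn i hv hw hvw
    obtain rfl := hf.lift_unique hF hG h.symm
    exact hij rfl
  mapsTo' := by
    rintro n ⟨i, F, hF⟩
    obtain ⟨I, hI⟩ := CWComplex.mapsTo n i
    -- The frontier of the lifted cell is compact, so it meets only finitely many lifts of the
    -- finitely many cells in `I`.
    have hK : IsCompact (F '' Metric.sphere 0 1) := (isCompact_sphere _ _).image F.continuous
    have hfin (m : ℕ) : {c : Σ j : cell (univ : Set X) m,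
        {F : C(Fin m → ℝ, E) // ∀ w, f (F w) = charMap m j w} | c.1 ∈ I m ∧
        (c.2.1 '' Metric.closedBall 0 1 ∩ F '' Metric.sphere 0 1).Nonempty}.Finite := by
      have h := (I m).finite_toSet.biUnion fun j _ ↦
        ((hf.finite_lifts_meeting hK j).preimage Subtype.val_injective.injOn).image
          (Sigma.mk (β := fun j : cell (univ : Set X) m ↦
            {F : C(Fin m → ℝ, E) // ∀ w, f (F w) = charMap m j w}) j)
      refine h.subset ?_
      rintro ⟨j, G⟩ ⟨hj, hG⟩
      exact mem_biUnion hj ⟨G, ⟨G.2, hG⟩, rfl⟩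
    refine ⟨fun m ↦ (hfin m).toFinset, fun v hv ↦ ?_⟩
    have hv' := hI hv
    simp only [mem_iUnion] at hv' ⊢
    obtain ⟨m, hm, j, hj, w, hw, hwv⟩ := hv'
    rw [← charMap_of_mem j hw, ← charMap_of_mem i (Metric.sphere_subset_closedBall hv),
      ← hF] at hwv
    obtain ⟨G, hG, hGw⟩ := hf.exists_lift j w (F v) hwv.symm
    refine ⟨m, hm, ⟨j, G, hG⟩, ?_, w, hw, hGw⟩
    simp only [Finite.mem_toFinset]
    exact ⟨hj, F v, ⟨w, hw, hGw⟩, v, hv, rfl⟩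
  closed' A _ hA := by
    have hpre {n : ℕ} (j : cell (univ : Set X) n) (F : C(Fin n → ℝ, E))
        (hF : ∀ w, f (F w) = charMap n j w) : IsOpen (F ⁻¹' Aᶜ) := by
      have h : IsClosed (A ∩ F '' Metric.closedBall 0 1) := hA n ⟨j, F, hF⟩
      rw [hf.lift_image_closedBall hF] at h
      rw [preimage_compl, ← preimage_inter_range]
      exact (h.preimage F.continuous).isOpen_compl
    rw [← isOpen_compl_iff, isOpen_iff_mem_nhds]
    intro y hy
    obtain ⟨e, hye, he⟩ := hf.isLocalHomeomorph y
    -- Openness is tested downstairs, in the weak topology of `X`: the preimage under a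
    -- characteristic map is the union of the preimages under its lifts.
    have hO : IsOpen (f '' (e.source ∩ Aᶜ)) := by
      refine isOpen_of_charMap_preimage fun n j ↦ ?_
      have : charMap n j ⁻¹' (f '' (e.source ∩ Aᶜ)) =
          ⋃ F : {F : C(Fin n → ℝ, E) // ∀ w, f (F w) = charMap n j w},
            F.1 ⁻¹' (e.source ∩ Aᶜ) := by
        ext v
        simp only [mem_iUnion]
        constructor
        · rintro ⟨w, hw, hwv⟩
          obtain ⟨F, hF, rfl⟩ := hf.exists_lift j v w hwv
          exact ⟨⟨F, hF⟩, hw⟩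
        · rintro ⟨F, hFv⟩
          exact ⟨F.1 v, hFv, F.2 v⟩
      rw [this]
      exact isOpen_iUnion fun F ↦ (e.open_source.preimage F.1.continuous).inter (hpre j F.1 F.2)
    filter_upwards [(e.open_source.inter (hO.preimage hf.isLocalHomeomorph.continuous)).mem_nhds
      ⟨hye, y, ⟨hye, hy⟩, rfl⟩]
    rintro w ⟨hw, z, ⟨hz, hzA⟩, hzw⟩
    rw [he] at hzw
    rwa [← e.injOn hz hw hzw]
  union' := by
    refine eq_univ_of_forall fun y ↦ ?_
    obtain ⟨n, j, v, hv, hy⟩ := exists_charMap_eq (f y)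
    obtain ⟨F, hF, hFv⟩ := hf.exists_lift j v y hy.symm
    simp only [mem_iUnion]
    exact ⟨n, ⟨j, F, hF⟩, v, Metric.ball_subset_closedBall hv, hFv⟩

end IsCellwiseCovering

/-- A local homeomorphism of CW complexes that carries cells to cells homeomorphically and through
which all characteristic maps lift to characteristic maps. -/
structure IsCellularCovering [CWComplex (univ : Set X)] [CWComplex (univ : Set E)] (f : E → X) :
    Prop where
  isLocalHomeomorph : IsLocalHomeomorph f
  exists_comp_charMap : ∀ {n : ℕ} (c : cell (univ : Set E) n),
    ∃ j : cell (univ : Set X) n, ∀ w, f (charMap n c w) = charMap n j w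
  exists_lift : ∀ {n : ℕ} (j : cell (univ : Set X) n) (v : Fin n → ℝ) (y : E),
    f y = charMap n j v →
      ∃ c : cell (univ : Set E) n, (∀ w, f (charMap n c w) = charMap n j w) ∧ charMap n c v = y

theorem IsCellwiseCovering.charMap_cwComplex [CWComplex (univ : Set X)] [T2Space X] [T2Space E]
    {f : E → X} (hf : IsCellwiseCovering f) {n : ℕ}
    (c : Σ j : cell (univ : Set X) n, {F : C(Fin n → ℝ, E) // ∀ w, f (F w) = charMap n j w}) :
    letI := hf.cwComplex
    charMap (C := (univ : Set E)) n c = c.2.1 :=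
  DFunLike.ext _ _ fun v ↦ hf.lift_ballRetraction c.2.2 v

theorem IsCellwiseCovering.isCellularCovering [CWComplex (univ : Set X)] [T2Space X] [T2Space E]
    {f : E → X} (hf : IsCellwiseCovering f) :
    letI := hf.cwComplex
    IsCellularCovering f := by
  let := hf.cwComplex
  refine ⟨hf.isLocalHomeomorph, ?_, ?_⟩
  · rintro n ⟨j, F⟩
    refine ⟨j, fun w ↦ ?_⟩
    rw [hf.charMap_cwComplex]
    exact F.2 w
  · intro n j v y hy
    obtain ⟨F, hF, hFv⟩ := hf.exists_lift j v y hy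
    refine ⟨⟨j, F, hF⟩, ?_, ?_⟩ <;> rw [hf.charMap_cwComplex]
    exacts [hF, hFv]

/-- A connected cellwise covering of a CW complex with countably many cells has countably many
cells. -/
theorem IsCellwiseCovering.countable_cell [CWComplex (univ : Set X)] [T2Space X] [T2Space E]
    [PreconnectedSpace E] {f : E → X} (hf : IsCellwiseCovering f)
    (hX : ∀ n, Countable (cell (univ : Set X) n)) (n : ℕ) :
    letI := hf.cwComplex
    Countable (cell (univ : Set E) n) := by
  let := hf.cwComplex
  suffices Countable (Σ n, cell (univ : Set E) n) from
    (sigma_mk_injective (β := cell (univ : Set E)) (i := n)).countable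
  refine countable_sigma_cell fun a ↦ ?_
  have h := countable_iUnion fun m ↦ countable_iUnion fun j : cell (univ : Set X) m ↦
    ((hf.finite_lifts_meeting (CWComplex.isCompact_closedCell (i := a.2)) j).preimage
      Subtype.val_injective.injOn).countable.image fun F ↦
        (⟨m, j, F⟩ : Σ n, cell (univ : Set E) n)
  refine h.mono ?_
  rintro ⟨m, j, F⟩ hb
  simp only [mem_iUnion]
  refine ⟨m, j, F, ⟨F.2, ?_⟩, rfl⟩
  rw [inter_comm]
  exact hb

end Topology.CWComplex

/-! ### Radial collars of open subsets of a skeleton -/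

namespace Topology.CWComplex

section Collar

variable {X : Type u} [TopologicalSpace X] [CWComplex (univ : Set X)]

/-- The set obtained from `V` by adding, in each `n`-cell, the open radial collar of the part of the
boundary of the cell that is mapped to `V`. -/
def collar (n : ℕ) (V : Set X) : Set X :=
  V ∪ {x | ∃ (j : cell (univ : Set X) n) (v : Fin n → ℝ), v ∈ Metric.ball 0 1 ∧ v ≠ 0 ∧
    charMap n j (‖v‖⁻¹ • v) ∈ V ∧ charMap n j v = x}

variable [T2Space X]

/-- `V` is a relatively open subset of the union of the cells of dimension less than `n`. -/
structure IsOpenInSkeleton (n : ℕ) (V : Set X) : Prop where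
  subset : V ⊆ skeletonLT (univ : Set X) n
  isClosed_diff : IsClosed ((skeletonLT (univ : Set X) n : Set X) \ V)

theorem charMap_sphere_mem_skeletonLT {n : ℕ} (j : cell (univ : Set X) n) {v : Fin n → ℝ}
    (hv : v ∈ Metric.sphere (0 : Fin n → ℝ) 1) :
    charMap n j v ∈ (skeletonLT (univ : Set X) n : Set X) :=
  CWComplex.cellFrontier_subset_skeletonLT n j (charMap_mem_cellFrontier j hv)

theorem charMap_ball_notMem_skeletonLT {n : ℕ} (j : cell (univ : Set X) n) {v : Fin n → ℝ}
    (hv : v ∈ Metric.ball (0 : Fin n → ℝ) 1) :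
    charMap n j v ∉ (skeletonLT (univ : Set X) n : Set X) := fun h ↦
  (CWComplex.disjoint_skeletonLT_openCell le_rfl).notMem_of_mem_left h (charMap_mem_openCell j hv)

theorem closedCell_subset_skeletonLT_of_lt {m n : ℕ} (h : m < n) (j : cell (univ : Set X) m) :
    closedCell m j ⊆ skeletonLT (univ : Set X) n :=
  (CWComplex.closedCell_subset_skeletonLT m j).trans
    (CWComplex.skeletonLT_mono (by exact_mod_cast h))

theorem disjoint_skeletonLT_openCell_of_le {m n : ℕ} (h : n ≤ m) (j : cell (univ : Set X) m) :
    Disjoint (skeletonLT (univ : Set X) n : Set X) (openCell m j) :=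
  CWComplex.disjoint_skeletonLT_openCell (by exact_mod_cast h)

theorem mem_collar_iff_of_mem_skeletonLT {n : ℕ} {V : Set X} {x : X}
    (hx : x ∈ (skeletonLT (univ : Set X) n : Set X)) : x ∈ collar n V ↔ x ∈ V := by
  refine ⟨?_, fun h ↦ .inl h⟩
  rintro (h | ⟨j, v, hv, -, -, rfl⟩)
  · exact h
  · exact absurd hx (charMap_ball_notMem_skeletonLT j hv)

/-- On the sphere `‖v‖⁻¹ • v` is `v` itself, so the radial description of the collar is valid up to
the boundary. -/
theorem charMap_mem_collar {n : ℕ} {V : Set X} (hV : V ⊆ skeletonLT (univ : Set X) n)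
    (j : cell (univ : Set X) n) {v : Fin n → ℝ} (hv : v ∈ Metric.closedBall (0 : Fin n → ℝ) 1) :
    charMap n j v ∈ collar n V ↔ v ≠ 0 ∧ charMap n j (‖v‖⁻¹ • v) ∈ V := by
  rw [← Metric.ball_union_sphere] at hv
  rcases hv with hv | hv
  · constructor
    · rintro (h | ⟨i, w, hw, hw0, hwV, hwv⟩)
      · exact absurd (hV h) (charMap_ball_notMem_skeletonLT j hv)
      · obtain ⟨rfl, rfl⟩ := eq_of_charMap_eq hw hv hwv
        exact ⟨hw0, hwV⟩
    · rintro ⟨hv0, hvV⟩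
      exact .inr ⟨j, v, hv, hv0, hvV, rfl⟩
  · rw [mem_collar_iff_of_mem_skeletonLT (charMap_sphere_mem_skeletonLT j hv)]
    have h : ‖v‖ = 1 := mem_sphere_zero_iff_norm.1 hv
    have hv0 : v ≠ 0 := by
      rintro rfl
      simp at h
    simp [h, hv0]

theorem IsOpenInSkeleton.collar {n : ℕ} {V : Set X} (hV : IsOpenInSkeleton n V) :
    IsOpenInSkeleton (n + 1) (collar n V) := by
  constructor
  · rintro _ (h | ⟨j, v, -, -, -, rfl⟩)
    · exact CWComplex.skeletonLT_mono (by exact_mod_cast n.le_succ) (hV.subset h)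
    · exact closedCell_subset_skeletonLT_of_lt n.lt_succ_self j (charMap_mem_closedCell j v)
  refine CWComplex.isClosed_of_disjoint_openCell_or_isClosed_inter_closedCell (subset_univ _)
    fun m _ j ↦ ?_
  rcases lt_trichotomy m n with h | rfl | h
  · refine .inr ?_
    convert! hV.isClosed_diff.inter (CWComplex.isClosed_closedCell (i := j)) using 1
    ext x
    refine and_congr_left fun hx ↦ ?_
    rw [mem_sdiff, mem_sdiff, mem_collar_iff_of_mem_skeletonLT
      (closedCell_subset_skeletonLT_of_lt h j hx)]
    exact and_congr_left fun _ ↦ iff_of_true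
      (closedCell_subset_skeletonLT_of_lt (h.trans n.lt_succ_self) j hx)
      (closedCell_subset_skeletonLT_of_lt h j hx)
  · refine .inr ?_
    -- The open cone on the part of the sphere sent to `V`, without its apex, where radial
    -- projection is not continuous. It is cut out by a closed set of `X` because `V` need not be
    -- open in `X`.
    let O : Set (Fin m → ℝ) := {0}ᶜ ∩ (fun v ↦ charMap m j (‖v‖⁻¹ • v)) ⁻¹'
      ((skeletonLT (univ : Set X) m : Set X) \ V)ᶜ
    have hO : IsOpen O := by
      refine ContinuousOn.isOpen_inter_preimage ?_ isOpen_compl_singleton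
        hV.isClosed_diff.isOpen_compl
      refine (charMap m j).continuous.comp_continuousOn ?_
      exact (continuousOn_id.norm.inv₀ fun v hv ↦ by simpa using hv).smul continuousOn_id
    have hOV {v : Fin m → ℝ} : v ∈ O ↔ v ≠ 0 ∧ charMap m j (‖v‖⁻¹ • v) ∈ V := by
      refine and_congr_right fun hv ↦ ?_
      have := charMap_sphere_mem_skeletonLT j (norm_inv_smul_mem_sphere hv)
      simp only [mem_preimage, mem_compl_iff, mem_sdiff, this, true_and, not_not]
    have : ((skeletonLT (univ : Set X) (m + 1 : ℕ) : Set X) \ CWComplex.collar m V) ∩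
        closedCell m j = charMap m j '' (Metric.closedBall 0 1 ∩ Oᶜ) := by
      ext x
      constructor
      · rintro ⟨⟨-, hx⟩, hxj⟩
        rw [← charMap_image_closedBall] at hxj
        obtain ⟨v, hv, rfl⟩ := hxj
        rw [charMap_mem_collar hV.subset j hv, ← hOV] at hx
        exact ⟨v, ⟨hv, hx⟩, rfl⟩
      · rintro ⟨v, ⟨hv, hvO⟩, rfl⟩
        refine ⟨⟨closedCell_subset_skeletonLT_of_lt m.lt_succ_self j
          (charMap_mem_closedCell j v), ?_⟩, charMap_mem_closedCell j v⟩
        rwa [charMap_mem_collar hV.subset j hv, ← hOV]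
    rw [this]
    exact (((isCompact_closedBall _ _).inter_right hO.isClosed_compl).image
      (charMap m j).continuous).isClosed
  · exact .inl ((disjoint_skeletonLT_openCell_of_le h j).mono_left sdiff_subset)

/-- Another cell of dimension at most `n` misses this open cell entirely, frontier included; the
cell itself leaves its closed frontier. -/
theorem isOpenInSkeleton_openCell {n : ℕ} (j : cell (univ : Set X) n) :
    IsOpenInSkeleton (n + 1) (openCell n j) := by
  constructor
  · exact (RelCWComplex.openCell_subset_closedCell n j).trans
      (closedCell_subset_skeletonLT_of_lt n.lt_succ_self j)
  refine CWComplex.isClosed_of_disjoint_openCell_or_isClosed_inter_closedCell (subset_univ _)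
    fun m _ i ↦ ?_
  rcases lt_or_ge n m with h | h
  · exact .inl ((disjoint_skeletonLT_openCell_of_le h i).mono_left sdiff_subset)
  refine .inr ?_
  have hd : Disjoint (cellFrontier m i) (openCell n j) :=
    (disjoint_skeletonLT_openCell_of_le h j).mono_left
      (CWComplex.cellFrontier_subset_skeletonLT m i)
  have hs : closedCell m i ⊆ skeletonLT (univ : Set X) (n + 1 : ℕ) :=
    closedCell_subset_skeletonLT_of_lt (Nat.lt_succ_of_le h) i
  rw [sdiff_eq, inter_right_comm, inter_eq_right.2 hs, ← sdiff_eq,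
    ← RelCWComplex.cellFrontier_union_openCell_eq_closedCell, union_sdiff_distrib,
    hd.sdiff_eq_left]
  by_cases hij : (⟨m, i⟩ : Σ n, cell (univ : Set X) n) = ⟨n, j⟩
  · obtain ⟨rfl, hij⟩ := Sigma.mk.inj hij
    obtain rfl := eq_of_heq hij
    rw [sdiff_self, union_empty]
    exact CWComplex.isClosed_cellFrontier
  · rw [(RelCWComplex.disjoint_openCell_of_ne hij).sdiff_eq_left,
      RelCWComplex.cellFrontier_union_openCell_eq_closedCell]
    exact CWComplex.isClosed_closedCell

theorem skeletonLT_eq_univ {N : ℕ} (hN : ∀ n, N ≤ n → IsEmpty (cell (univ : Set X) n)) {n : ℕ}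
    (hn : N ≤ n) : (skeletonLT (univ : Set X) n : Set X) = univ := by
  refine eq_univ_of_forall fun x ↦ ?_
  obtain ⟨m, j, hx⟩ := exists_mem_openCell x
  have hm : m < n := by
    by_contra h
    exact (hN m (hn.trans (not_lt.1 h))).elim j
  exact closedCell_subset_skeletonLT_of_lt hm j (RelCWComplex.openCell_subset_closedCell m j hx)

theorem IsOpenInSkeleton.isOpen {n : ℕ} {V : Set X} (hV : IsOpenInSkeleton n V)
    (h : (skeletonLT (univ : Set X) n : Set X) = univ) : IsOpen V := by
  rw [← isClosed_compl_iff, compl_eq_univ_sdiff, ← h]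
  exact hV.isClosed_diff

end Collar

/-! ### Even covering, one skeleton at a time -/

section EvenCover

variable {X E ι : Type u} [TopologicalSpace X] [TopologicalSpace E]
  [CWComplex (univ : Set X)] [CWComplex (univ : Set E)] {f : E → X}

theorem IsCellularCovering.charMap_eq [T2Space E] (hf : IsCellularCovering f) {n : ℕ}
    {c d : cell (univ : Set E) n} {j : cell (univ : Set X) n}
    (hc : ∀ w, f (charMap n c w) = charMap n j w) (hd : ∀ w, f (charMap n d w) = charMap n j w)
    {v : Fin n → ℝ} (h : charMap n c v = charMap n d v) : charMap n c = charMap n d :=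
  DFunLike.coe_injective <| (T2Space.isSeparatedMap f).eq_of_comp_eq
    hf.isLocalHomeomorph.isLocallyInjective (charMap n c).continuous (charMap n d).continuous
    (funext fun w ↦ (hc w).trans (hd w).symm) v h

variable [T2Space X] [T2Space E]

/-- The sets `W i` are disjoint sheets over `V`, relatively open in the skeleton of cells of
dimension less than `n`. -/
structure IsEvenlyCoveredInSkeleton (f : E → X) (n : ℕ) (V : Set X) (W : ι → Set E) : Prop where
  base : IsOpenInSkeleton n V
  sheet : ∀ i, IsOpenInSkeleton n (W i)
  bijOn : ∀ i, BijOn f (W i) V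
  exists_mem : ∀ y, f y ∈ V → ∃ i, y ∈ W i
  eq_of_mem : ∀ {i k y}, y ∈ W i → y ∈ W k → i = k

/-- A collar point determines a boundary point in `V` by radial projection. Unique lifting of the
characteristic map transports the sheet of that boundary point to the collar point. -/
theorem IsEvenlyCoveredInSkeleton.collar (hf : IsCellularCovering f) {n : ℕ} {V : Set X}
    {W : ι → Set E} (h : IsEvenlyCoveredInSkeleton f n V W) :
    IsEvenlyCoveredInSkeleton f (n + 1) (collar n V) (fun i ↦ collar n (W i)) where
  base := h.base.collar
  sheet i := (h.sheet i).collar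
  bijOn i := by
    refine ⟨?_, ?_, ?_⟩
    · rintro _ (hy | ⟨c, v, hv, hv0, hvW, rfl⟩)
      · exact .inl ((h.bijOn i).mapsTo hy)
      · obtain ⟨j, hj⟩ := hf.exists_comp_charMap c
        exact .inr ⟨j, v, hv, hv0, hj _ ▸ (h.bijOn i).mapsTo hvW, (hj v).symm⟩
    · have key {y : E} (hy : y ∈ W i) (c : cell (univ : Set E) n) {v : Fin n → ℝ}
          (hv : v ∈ Metric.ball (0 : Fin n → ℝ) 1) : f y ≠ f (charMap n c v) := by
        intro he
        obtain ⟨j, hj⟩ := hf.exists_comp_charMap c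
        refine charMap_ball_notMem_skeletonLT j hv ?_
        rw [← hj, ← he]
        exact h.base.subset ((h.bijOn i).mapsTo hy)
      rintro _ (hy | ⟨c, v, hv, hv0, hvW, rfl⟩) _ (hz | ⟨d, w, hw, hw0, hwW, rfl⟩) he
      · exact (h.bijOn i).injOn hy hz he
      · exact absurd he (key hy d hw)
      · exact absurd he.symm (key hz c hv)
      · obtain ⟨j, hj⟩ := hf.exists_comp_charMap c
        obtain ⟨k, hk⟩ := hf.exists_comp_charMap d
        rw [hj, hk] at he
        obtain ⟨rfl, rfl⟩ := eq_of_charMap_eq hv hw he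
        have := (h.bijOn i).injOn hvW hwW ((hj _).trans (hk _).symm)
        rw [hf.charMap_eq hj hk this]
    · rintro _ (hx | ⟨j, v, hv, hv0, hvV, rfl⟩)
      · obtain ⟨y, hy, rfl⟩ := (h.bijOn i).surjOn hx
        exact ⟨y, .inl hy, rfl⟩
      · obtain ⟨y, hy, hyv⟩ := (h.bijOn i).surjOn hvV
        obtain ⟨c, hc, rfl⟩ := hf.exists_lift j _ y hyv
        exact ⟨charMap n c v, .inr ⟨c, v, hv, hv0, hy, rfl⟩, hc v⟩
  exists_mem := by
    rintro y (hy | ⟨j, v, hv, hv0, hvV, hvy⟩)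
    · exact (h.exists_mem y hy).imp fun _ ↦ .inl
    · obtain ⟨c, hc, rfl⟩ := hf.exists_lift j v y hvy.symm
      obtain ⟨i, hi⟩ := h.exists_mem (charMap n c (‖v‖⁻¹ • v)) (by rwa [hc])
      exact ⟨i, .inr ⟨c, v, hv, hv0, hi, rfl⟩⟩
  eq_of_mem := by
    rintro i k y (hy | ⟨c, v, hv, hv0, hvW, rfl⟩) hk
    · rw [mem_collar_iff_of_mem_skeletonLT ((h.sheet i).subset hy)] at hk
      exact h.eq_of_mem hy hk
    · rw [charMap_mem_collar (h.sheet k).subset c (Metric.ball_subset_closedBall hv)] at hk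
      exact h.eq_of_mem hvW hk.2

theorem IsCellularCovering.isEvenlyCoveredInSkeleton_openCell (hf : IsCellularCovering f) {n : ℕ}
    (j : cell (univ : Set X) n) :
    IsEvenlyCoveredInSkeleton f (n + 1) (openCell n j)
      (fun c : {c : cell (univ : Set E) n // ∀ w, f (charMap n c w) = charMap n j w} ↦
        openCell n c.1) where
  base := isOpenInSkeleton_openCell j
  sheet c := isOpenInSkeleton_openCell c.1
  bijOn c := by
    simp only [← charMap_image_ball]
    refine ⟨?_, ?_, ?_⟩
    · rintro _ ⟨v, hv, rfl⟩
      exact ⟨v, hv, (c.2 v).symm⟩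
    · rintro _ ⟨v, hv, rfl⟩ _ ⟨w, hw, rfl⟩ h
      rw [c.2, c.2] at h
      rw [charMap_injOn j hv hw h]
    · rintro _ ⟨v, hv, rfl⟩
      exact ⟨_, ⟨v, hv, rfl⟩, c.2 v⟩
  exists_mem y hy := by
    rw [← charMap_image_ball] at hy
    obtain ⟨v, hv, hvy⟩ := hy
    obtain ⟨c, hc, rfl⟩ := hf.exists_lift j v y hvy.symm
    exact ⟨⟨c, hc⟩, charMap_mem_openCell c hv⟩
  eq_of_mem {c d y} hc hd := by
    simp only [← charMap_image_ball] at hc hd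
    obtain ⟨v, hv, rfl⟩ := hc
    obtain ⟨w, hw, hwv⟩ := hd
    exact Subtype.ext (eq_of_charMap_eq hv hw hwv.symm).1

theorem IsEvenlyCoveredInSkeleton.exists_of_le (hf : IsCellularCovering f) {n m : ℕ} (hnm : n ≤ m)
    {V : Set X} {W : ι → Set E} (h : IsEvenlyCoveredInSkeleton f n V W) :
    ∃ (V' : Set X) (W' : ι → Set E), V ⊆ V' ∧ IsEvenlyCoveredInSkeleton f m V' W' := by
  induction m, hnm using Nat.le_induction with
  | base => exact ⟨V, W, subset_rfl, h⟩
  | succ m _ ih =>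
    obtain ⟨V', W', hV, h'⟩ := ih
    exact ⟨_, _, hV.trans subset_union_left, h'.collar hf⟩

end EvenCover

/-- A point with an open neighbourhood over which a local homeomorphism decomposes into disjoint
open sheets is evenly covered. -/
theorem _root_.IsLocalHomeomorph.isEvenlyCovered_of_sheets {X E ι : Type*} [TopologicalSpace X]
    [TopologicalSpace E] {f : E → X} (hf : IsLocalHomeomorph f) {V : Set X} {W : ι → Set E}
    (hV : IsOpen V) (hW : ∀ i, IsOpen (W i)) (hbij : ∀ i, BijOn f (W i) V)
    (hex : ∀ y, f y ∈ V → ∃ i, y ∈ W i) (heq : ∀ {i k y}, y ∈ W i → y ∈ W k → i = k) {x : X}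
    (hx : x ∈ V) : IsEvenlyCovered f x (f ⁻¹' {x}) := by
  let _ : TopologicalSpace ι := ⊥
  have : DiscreteTopology ι := ⟨rfl⟩
  choose σ hσ using hex
  choose s hs using fun i ↦ (hbij i).surjOn
  let H : f ⁻¹' V ≃ V × ι :=
    { toFun y := (⟨f y, y.2⟩, σ y y.2)
      invFun p := ⟨s p.2 p.1.2, by simp only [mem_preimage, (hs p.2 p.1.2).2, p.1.2]⟩
      left_inv y := Subtype.ext <| (hbij (σ y y.2)).injOn (hs _ y.2).1 (hσ y y.2) (hs _ y.2).2
      right_inv p := Prod.ext (Subtype.ext (hs p.2 p.1.2).2) (heq (hσ _ _) (hs p.2 p.1.2).1) }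
  have hcont : Continuous H := by
    refine ((hf.continuous.comp continuous_subtype_val).subtype_mk _).prodMk ?_
    refine continuous_discrete_rng.2 fun i ↦ ?_
    have : (fun y : f ⁻¹' V ↦ σ y y.2) ⁻¹' {i} = Subtype.val ⁻¹' W i := by
      ext y
      exact ⟨fun h ↦ h ▸ hσ y y.2, fun h ↦ heq (hσ y y.2) h⟩
    rw [this]
    exact (hW i).preimage continuous_subtype_val
  have hfV : IsOpen (f ⁻¹' V) := hV.preimage hf.continuous
  have hopen : IsOpenMap H := by
    intro O hO
    have hO' : IsOpen (Subtype.val '' O) := hfV.isOpenMap_subtype_val O hO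
    have : H '' O = ⋃ i, (Subtype.val ⁻¹' (f '' (Subtype.val '' O ∩ W i))) ×ˢ {i} := by
      ext ⟨v, k⟩
      simp only [mem_iUnion, mem_prod, mem_singleton_iff]
      constructor
      · rintro ⟨y, hy, hyv⟩
        obtain ⟨rfl, rfl⟩ := Prod.mk.inj hyv
        exact ⟨_, ⟨y, ⟨⟨y, hy, rfl⟩, hσ y y.2⟩, rfl⟩, rfl⟩
      · rintro ⟨i, ⟨_, ⟨⟨y, hy, rfl⟩, hyW⟩, hyv⟩, rfl⟩
        exact ⟨y, hy, Prod.ext (Subtype.ext hyv) (heq (hσ y y.2) hyW)⟩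
    rw [this]
    exact isOpen_iUnion fun i ↦ ((hf.isOpenMap _ (hO'.inter (hW i))).preimage
      continuous_subtype_val).prod (isOpen_discrete _)
  exact IsEvenlyCovered.to_isEvenlyCovered_preimage (I := ι)
    ⟨this, V, hx, hV, hfV, H.toHomeomorphOfContinuousOpen hcont hopen, fun _ ↦ rfl⟩

/-- A cellular covering of a finite-dimensional CW complex is a covering map. -/
theorem IsCellularCovering.isCoveringMap {X E : Type u} [TopologicalSpace X] [TopologicalSpace E]
    [CWComplex (univ : Set X)] [CWComplex (univ : Set E)] [T2Space X] [T2Space E] {f : E → X}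
    (hf : IsCellularCovering f) {N : ℕ} (hN : ∀ n, N ≤ n → IsEmpty (cell (univ : Set X) n)) :
    IsCoveringMap f := by
  intro x
  obtain ⟨n, j, hx⟩ := exists_mem_openCell x
  -- The open cell starts in the skeleton below `n + 1`; collaring up to at least `N` makes the
  -- skeleton the whole space.
  obtain ⟨V, W, hV, h⟩ := (hf.isEvenlyCoveredInSkeleton_openCell j).exists_of_le hf
    (le_max_left (n + 1) N)
  have hE : ∀ n, N ≤ n → IsEmpty (cell (univ : Set E) n) := fun n hn ↦
    ⟨fun c ↦ (hN n hn).elim (hf.exists_comp_charMap c).choose⟩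
  exact hf.isLocalHomeomorph.isEvenlyCovered_of_sheets
    (h.base.isOpen (skeletonLT_eq_univ hN (le_max_right _ _)))
    (fun i ↦ (h.sheet i).isOpen (skeletonLT_eq_univ hE (le_max_right _ _)))
    h.bijOn h.exists_mem h.eq_of_mem (hV hx)

end Topology.CWComplex

/-! ### General facts on covering maps -/

theorem IsCoveringMap.t2Space {X E : Type*} [TopologicalSpace X] [TopologicalSpace E] [T2Space X]
    {f : E → X} (hf : IsCoveringMap f) : T2Space E := by
  refine ⟨fun x y hxy ↦ ?_⟩
  by_cases h : f x = f y
  · exact hf.isSeparatedMap x y h hxy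
  · exact separated_by_continuous hf.continuous h

theorem IsCoveringMap.isClopen_range {X E : Type*} [TopologicalSpace X] [TopologicalSpace E]
    {f : E → X} (hf : IsCoveringMap f) : IsClopen (range f) := by
  refine ⟨isOpen_compl_iff.1 (isOpen_iff_mem_nhds.2 fun x hx ↦ ?_), hf.isOpenMap.isOpen_range⟩
  obtain ⟨-, U, hxU, hU, -, H, hH⟩ := hf x
  filter_upwards [hU.mem_nhds hxU]
  rintro _ hyU ⟨y, rfl⟩
  -- The second coordinate of the trivialization is a point of the fibre over `x`, which is empty.
  exact hx ⟨_, (H ⟨y, hyU⟩).2.2⟩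

theorem IsCoveringMap.surjective {X E : Type*} [TopologicalSpace X] [TopologicalSpace E]
    [PreconnectedSpace X] [Nonempty E] {f : E → X} (hf : IsCoveringMap f) :
    Function.Surjective f :=
  range_eq_univ.1 (hf.isClopen_range.eq_univ (range_nonempty f))

/-! ### Permanence of cellwise coverings; components of preimages -/

namespace Topology.CWComplex

variable {X E : Type u} [TopologicalSpace X] [TopologicalSpace E] [CWComplex (univ : Set X)]

/-- Maps out of the simply connected space `ℝⁿ` lift through coverings; this is the gain from
extending characteristic maps beyond the ball. -/
theorem _root_.IsCoveringMap.isCellwiseCovering {f : E → X} (hf : IsCoveringMap f) :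
    IsCellwiseCovering f where
  isLocalHomeomorph := hf.isLocalHomeomorph
  exists_lift {n} j v y hy := by
    obtain ⟨F, ⟨hFv, hF⟩, -⟩ := hf.existsUnique_continuousMap_lifts (charMap n j) v y hy
    exact ⟨F, congrFun hF, hFv⟩

/-- Restricting a cellwise covering to a clopen part of its total space. -/
theorem IsCellwiseCovering.comp_isOpenEmbedding {E' : Type u} [TopologicalSpace E'] {f : E → X}
    (hf : IsCellwiseCovering f) {i : E' → E} (hi : IsOpenEmbedding i) (hc : IsClosed (range i)) :
    IsCellwiseCovering (f ∘ i) where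
  isLocalHomeomorph := hf.isLocalHomeomorph.comp hi.isLocalHomeomorph
  exists_lift {n} j v y hy := by
    obtain ⟨F, hF, hFv⟩ := hf.exists_lift j v (i y) hy
    have hr : range F ⊆ range i :=
      (isPreconnected_range F.continuous).subset_isClopen ⟨hc, hi.isOpen_range⟩
        ⟨F v, mem_range_self v, hFv ▸ mem_range_self y⟩
    choose G hG using fun w ↦ hr (mem_range_self w)
    have hGc : Continuous G := hi.isInducing.continuous_iff.2 (by
      convert! F.continuous using 1
      exact funext hG)
    refine ⟨⟨G, hGc⟩, fun w ↦ ?_, hi.injective ((hG v).trans hFv)⟩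
    exact (congrArg f (hG w)).trans (hF w)

theorem IsCellwiseCovering.comp_isCoveringMap {E' : Type u} [TopologicalSpace E'] {f : E → X}
    (hf : IsCellwiseCovering f) {r : E' → E} (hr : IsCoveringMap r) :
    IsCellwiseCovering (f ∘ r) where
  isLocalHomeomorph := hf.isLocalHomeomorph.comp hr.isLocalHomeomorph
  exists_lift {n} j v y hy := by
    obtain ⟨F, hF, hFv⟩ := hf.exists_lift j v (r y) hy
    obtain ⟨G, ⟨hGv, hG⟩, -⟩ := hr.existsUnique_continuousMap_lifts F v y hFv.symm
    exact ⟨G, fun w ↦ (congrArg f (congrFun hG w)).trans (hF w), hGv⟩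

/-- A component of the preimage of a subcomplex under a cellular covering, as a subcomplex. -/
noncomputable def componentSubcomplex [T2Space X] [T2Space E] [CWComplex (univ : Set E)] {f : E → X}
    (hf : IsCellularCovering f) (Q : CWComplex.Subcomplex (univ : Set X)) (e : E) :
    CWComplex.Subcomplex (univ : Set E) :=
  CWComplex.Subcomplex.mk' univ (connectedComponentIn (f ⁻¹' Q) e)
    (fun n ↦ {c | openCell n c ⊆ connectedComponentIn (f ⁻¹' Q) e})
    (by
      rintro n ⟨c, hc⟩
      have hx : charMap n c 0 ∈ connectedComponentIn (f ⁻¹' Q) e :=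
        hc (charMap_mem_openCell c (by simp))
      refine Subset.trans ?_ (connectedComponentIn_eq hx).ge
      refine (isPreconnected_closedCell c).subset_connectedComponentIn
        (charMap_mem_closedCell c 0) ?_
      rw [← CWComplex.closure_openCell_eq_closedCell]
      exact closure_minimal (hc.trans (connectedComponentIn_subset _ _))
        (Q.closed.preimage hf.isLocalHomeomorph.continuous))
    (by
      refine (iUnion₂_subset fun n c ↦ c.2).antisymm fun y hy ↦ ?_
      obtain ⟨n, c, v, hv, rfl⟩ := exists_charMap_eq y
      refine mem_iUnion₂.2 ⟨n, ⟨c, ?_⟩, charMap_mem_openCell c hv⟩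
      refine Subset.trans ?_ (connectedComponentIn_eq hy).ge
      refine IsPreconnected.subset_connectedComponentIn ?_ (charMap_mem_openCell c hv) ?_
      · rw [← charMap_image_ball]
        exact (convex_ball _ _).isPreconnected.image _ (charMap n c).continuous.continuousOn
      · obtain ⟨j, hj⟩ := hf.exists_comp_charMap c
        -- An open cell of the base lies in `Q` or misses it.
        have hjQ : j ∈ Q.I n := by
          by_contra h
          refine (RelCWComplex.Subcomplex.disjoint_openCell_subcomplex_of_not_mem Q h
            ).notMem_of_mem_left (charMap_mem_openCell j hv) ?_
          rw [← hj]
          exact connectedComponentIn_subset (f ⁻¹' Q) e hy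
        rw [← charMap_image_ball]
        rintro _ ⟨w, hw, rfl⟩
        rw [mem_preimage, hj]
        exact CWComplex.Subcomplex.openCell_subset_of_mem Q hjQ (charMap_mem_openCell j hw))

end Topology.CWComplex

/-! ### Covers of 2-complexes and the main theorem -/

open Topology.CWComplex in
/-- The total space of a connected covering of a 2-complex is a 2-complex. -/
theorem IsTwoComplex.of_isCoveringMap {X E : Type u} [TopologicalSpace X] [TopologicalSpace E]
    [CWComplex (univ : Set X)] [T2Space X] [T2Space E] [ConnectedSpace E] (hX : IsTwoComplex X)
    {f : E → X} (hf : IsCoveringMap f) :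
    letI := hf.isCellwiseCovering.cwComplex
    IsTwoComplex E := by
  let := hf.isCellwiseCovering.cwComplex
  exact
    { t2 := inferInstance
      connected := inferInstance
      countable_cell := hf.isCellwiseCovering.countable_cell hX.countable_cell
      isEmpty_cell n hn := ⟨fun c ↦ (hX.isEmpty_cell n hn).elim
        (hf.isCellwiseCovering.isCellularCovering.exists_comp_charMap c).choose⟩ }

open Topology.CWComplex in
theorem lemma2p2
    (hcontr : ∀ (X : Type u) [TopologicalSpace X] [CWComplex (univ : Set X)],
      IsTwoComplex X → ContractibleSpace X →
        ∀ Q : CWComplex.Subcomplex (univ : Set X), IsConnected (Q : Set X) →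
          IsAspherical (Q : Set X)) :
    ∀ (P : Type u) [TopologicalSpace P] [CWComplex (univ : Set P)],
      IsTwoComplex P → IsAspherical P →
        ∀ Q : CWComplex.Subcomplex (univ : Set P), IsConnected (Q : Set P) →
          IsAspherical (Q : Set P) := by
  intro P _ _ hP hasph Q hQ
  obtain ⟨-, E, _, p, ⟨hp, _⟩, hE⟩ := hasph
  have := hP.t2
  have := hP.connected
  have := hp.t2Space
  let := hp.isCellwiseCovering.cwComplex
  obtain ⟨x, hx⟩ := hQ.nonempty
  obtain ⟨e, rfl⟩ := hp.surjective x
  have hK : IsAspherical (connectedComponentIn (p ⁻¹' Q) e) :=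
    hcontr E (hP.of_isCoveringMap hp) hE
      (componentSubcomplex hp.isCellwiseCovering.isCellularCovering Q e)
      (isConnected_connectedComponentIn_iff (F := p ⁻¹' (Q : Set P)).2 hx)
  obtain ⟨-, E', _, r, ⟨hr, _⟩, hE'⟩ := hK
  let := CWComplex.subtype (Q : Set P)
  let q : p ⁻¹' (Q : Set P) → Q := (Q : Set P).restrictPreimage p
  have hq : IsCoveringMap q := hp.restrictPreimage Q
  let := hq.isCellwiseCovering.cwComplex
  let i : connectedComponentIn (p ⁻¹' (Q : Set P)) e → p ⁻¹' (Q : Set P) :=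
    inclusion (connectedComponentIn_subset _ _)
  -- The preimage of `Q` is itself a CW complex, so its components are clopen and characteristic
  -- maps lift through one component.
  have hi : IsClopen (range i) := by
    have : range i = connectedComponent (⟨e, hx⟩ : p ⁻¹' (Q : Set P)) := by
      rw [range_inclusion, connectedComponentIn_eq_image (F := p ⁻¹' (Q : Set P)) hx]
      exact preimage_image_eq _ Subtype.val_injective
    rw [this]
    exact isClopen_connectedComponent _
  have hg : IsCellwiseCovering (q ∘ i ∘ r) :=
    (hq.isCellwiseCovering.comp_isOpenEmbedding
      ⟨IsEmbedding.inclusion _, hi.isOpen⟩ hi.isClosed).comp_isCoveringMap hr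
  have := hr.t2Space
  let := hg.cwComplex
  -- `N = 3` because `Q` has no cells of dimension above 2.
  have hcov : IsCoveringMap (q ∘ i ∘ r) := hg.isCellularCovering.isCoveringMap (N := 3)
    fun n hn ↦ ⟨fun c : Q.I n ↦ (hP.isEmpty_cell n hn).elim c.1⟩
  have := isConnected_iff_connectedSpace.1 hQ
  exact ⟨hcov.surjective.pathConnectedSpace hcov.continuous, E', _, _, ⟨hcov, ‹_›⟩, hE'⟩
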